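/- A convex body in $\mathbb{R}^n$ is a compact convex set with nonempty interior; $|A|$ denotes the $n$-dimensional Lebesgue measure of $A$, and sums and differences of sets are Minkowski sums and differences. Let $m \geq 1$, let $A_1,\dots,A_m$ be convex bodies in $\mathbb{R}^n$, and let $X_1,\dots,X_m$ be independent random vectors, with $X_i$ uniformly distributed in $A_i$ for each $i$. Then the sum $S_m = X_1+\dots+X_m$ has a density with respect to Lebesgue measure, and every density $f_m$ of $S_m$ satisfies, with $\|f_m\| = \operatorname{ess\,sup}_x f_m(x)$, $$1 \;\leq\; \|f_m\|\cdot|A_1+\dots+A_m| \;\leq\; (me)^n .$$ Consequently, for all convex bodies $A$ and $B$ in $\mathbb{R}^n$, $$\sup_{x\in\mathbb{R}^n} |(A-x)\cap B| \cdot |A-B| \;\leq\; (2e)^n\,|A|\,|B| .$$ -/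

import Mathlib

open scoped Pointwise ENNReal

/-- A convex body in `ℝⁿ`: a compact convex set with nonempty interior. -/
structure IsConvexBody {n : ℕ} (A : Set (EuclideanSpace ℝ (Fin n))) : Prop where
  convex : Convex ℝ A
  isCompact : IsCompact A
  nonempty_interior : (interior A).Nonempty

/-- `f` is a density, with respect to Lebesgue measure, of the random vector `S`. -/
structure IsDensityOf {Ω : Type*} [MeasurableSpace Ω] (P : MeasureTheory.Measure Ω) {n : ℕ}
    (S : Ω → EuclideanSpace ℝ (Fin n)) (f : EuclideanSpace ℝ (Fin n) → ℝ≥0∞) : Prop where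
  aemeasurable : AEMeasurable f MeasureTheory.volume
  map_eq : P.map S = MeasureTheory.volume.withDensity f

/-! Decay of degree `k` towards `K` replaces any appeal to concavity of powers of the density. The
normalised indicator of a convex body decays with degree `0` towards that body, and convolving adds
the degrees plus `n`, the Jacobian of a scaling, while the target sets add
(`DecaysTowards.lconvolution`). So the density of the sum has degree `n (m - 1)` towards `K = A₁ + ⋯
+ A_m`.

Shrinking `K` towards `x` by the ratio `1/m` gives a set of volume `m⁻ⁿ |K|` on which `f ≥ (1 - 1/m)
^ (n (m - 1)) f x`; integrating `f` over it yields the upper bound (`DecaysTowards.mul_volume_le`).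
The lower bound holds because `f` has mass `1` on `K`. -/

/-- Along the segment from `x` to a point `y` of `K`, the function `f` decays at most like the
`k`-th power of the distance to `y`. -/
def DecaysTowards {n : ℕ} (k : ℕ) (K : Set (EuclideanSpace ℝ (Fin n)))
    (f : EuclideanSpace ℝ (Fin n) → ℝ≥0∞) : Prop :=
  ∀ s t : ℝ, 0 ≤ s → 0 ≤ t → s + t = 1 → ∀ x, ∀ y ∈ K,
    ENNReal.ofReal s ^ k * f x ≤ f (s • x + t • y)

section

open MeasureTheory ProbabilityTheory

variable {n : ℕ}

namespace IsConvexBody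

variable {A : Set (EuclideanSpace ℝ (Fin n))}

theorem measurableSet (hA : IsConvexBody A) : MeasurableSet A :=
  hA.isCompact.measurableSet

theorem volume_ne_zero (hA : IsConvexBody A) : volume A ≠ 0 :=
  (Measure.measure_pos_of_nonempty_interior _ hA.nonempty_interior).ne'

theorem volume_ne_top (hA : IsConvexBody A) : volume A ≠ ∞ :=
  hA.isCompact.measure_lt_top.ne

theorem neg (hA : IsConvexBody A) : IsConvexBody (-A) where
  convex := hA.convex.neg
  isCompact := hA.isCompact.neg
  nonempty_interior := by
    obtain ⟨x, hx⟩ := hA.nonempty_interior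
    have h := (Homeomorph.neg (EuclideanSpace ℝ (Fin n))).preimage_interior A
    refine ⟨-x, ?_⟩
    change -x ∈ interior (Homeomorph.neg (EuclideanSpace ℝ (Fin n)) ⁻¹' A)
    rw [← h]
    simpa using hx

end IsConvexBody

theorem Convex.decaysTowards_indicator {A : Set (EuclideanSpace ℝ (Fin n))} (hA : Convex ℝ A)
    (c : ℝ≥0∞) : DecaysTowards 0 A (A.indicator fun _ => c) := by
  intro s t hs ht hst x y hy
  by_cases hx : x ∈ A
  · simp [hx, hA hx hy hs ht hst]
  · simp [hx]

theorem lintegral_comp_smul_add {h : EuclideanSpace ℝ (Fin n) → ℝ≥0∞} (hh : Measurable h)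
    {s : ℝ} (hs : 0 < s) (c : EuclideanSpace ℝ (Fin n)) :
    ENNReal.ofReal s ^ n * ∫⁻ z, h (s • z + c) = ∫⁻ z, h z := by
  have hmap : ∫⁻ z, h (s • z + c) =
      ENNReal.ofReal (|(s ^ n)⁻¹|) * ∫⁻ z, h (z + c) := by
    have := Measure.map_addHaar_smul (volume : Measure (EuclideanSpace ℝ (Fin n))) hs.ne'
    rw [finrank_euclideanSpace_fin] at this
    rw [← smul_eq_mul, ← lintegral_smul_measure, ← this,
      lintegral_map (by fun_prop) (by fun_prop)]
  rw [hmap, lintegral_add_right_eq_self, ← mul_assoc, ← ENNReal.ofReal_pow hs.le,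
    ← ENNReal.ofReal_mul (by positivity), abs_of_pos (by positivity),
    mul_inv_cancel₀ (by positivity)]
  simp

/-- For a target `a + b`, substitute `s • z + t • a` for the integration variable: the arguments of
`f` and `g` then move towards `a` and `b` separately, and the Jacobian `s ^ n` is the extra degree.
-/
theorem DecaysTowards.lconvolution {k l : ℕ} {K L : Set (EuclideanSpace ℝ (Fin n))}
    {f g : EuclideanSpace ℝ (Fin n) → ℝ≥0∞} (hf : DecaysTowards k K f) (hg : DecaysTowards l L g)
    (hfm : Measurable f) (hgm : Measurable g) :
    DecaysTowards (k + l + n) (K + L) (lconvolution f g volume) := by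
  rintro s t hs ht hst x _ ⟨a, ha, b, hb, rfl⟩
  -- At `s = 0` the substitution degenerates, but the left side vanishes unless `n = 0`, when the
  -- space is a single point.
  rcases hs.eq_or_lt with rfl | hs
  · rcases Nat.eq_zero_or_pos n with rfl | hn
    · refine (mul_le_of_le_one_left' (pow_le_one₀ zero_le (by simp))).trans_eq ?_
      congr 1
      exact Subsingleton.elim _ _
    · simp [hn.ne']
  simp only [lconvolution_def]
  rw [← lintegral_comp_smul_add (h := fun y => f y * g (-y + (s • x + t • (a + b))))
    (by fun_prop) hs (t • a), pow_add, mul_comm _ (ENNReal.ofReal s ^ n), mul_assoc]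
  gcongr
  rw [← lintegral_const_mul' _ _ (by finiteness)]
  refine lintegral_mono fun z => ?_
  have h1 := hf s t hs.le ht hst z a ha
  have h2 := hg s t hs.le ht hst (-z + x) b hb
  have h3 : -(s • z + t • a) + (s • x + t • (a + b)) = s • (-z + x) + t • b := by module
  simp only [h3, pow_add]
  calc _ = (ENNReal.ofReal s ^ k * f z) * (ENNReal.ofReal s ^ l * g (-z + x)) := by ring
    _ ≤ _ := by gcongr

theorem lintegral_lconvolution {f g : EuclideanSpace ℝ (Fin n) → ℝ≥0∞}
    (hf : Measurable f) (hg : Measurable g) :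
    ∫⁻ x, lconvolution f g volume x = (∫⁻ x, f x) * ∫⁻ x, g x := by
  simp only [lconvolution_def]
  rw [lintegral_lintegral_swap (by fun_prop), ← lintegral_mul_const _ hf]
  refine lintegral_congr fun y => ?_
  rw [lintegral_const_mul _ (by fun_prop), lintegral_add_left_eq_self]

/-- With `m = j + 1` this is `(1 + 1/j) ^ j ≤ e`; for `m = 1` it relies on `0 ^ 0 = 1`. -/
theorem one_le_exp_mul_one_sub_inv_pow {m : ℕ} (hm : 0 < m) :
    1 ≤ Real.exp 1 * (1 - (m : ℝ)⁻¹) ^ (m - 1) := by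
  obtain ⟨j, rfl⟩ := Nat.exists_eq_succ_of_ne_zero hm.ne'
  rcases Nat.eq_zero_or_pos j with rfl | hj
  · simp
  have hj' : (0 : ℝ) < j := by exact_mod_cast hj
  have h1 : (1 - ((j.succ : ℕ) : ℝ)⁻¹) = (1 + (j : ℝ)⁻¹)⁻¹ := by
    push_cast
    field_simp
    ring
  have h2 : (1 + (j : ℝ)⁻¹) ^ j ≤ Real.exp 1 := by
    calc (1 + (j : ℝ)⁻¹) ^ j ≤ Real.exp ((j : ℝ)⁻¹) ^ j := by
          gcongr
          linarith [Real.add_one_le_exp ((j : ℝ)⁻¹)]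
      _ = Real.exp 1 := by rw [← Real.exp_nat_mul, mul_inv_cancel₀ hj'.ne']
  rw [h1, Nat.succ_sub_one, inv_pow, ← div_eq_mul_inv, one_le_div (by positivity)]
  exact h2

theorem DecaysTowards.mul_volume_le {m : ℕ} (hm : 0 < m) {K : Set (EuclideanSpace ℝ (Fin n))}
    {f : EuclideanSpace ℝ (Fin n) → ℝ≥0∞} (hf : DecaysTowards (n * (m - 1)) K f)
    (hfm : Measurable f) (x : EuclideanSpace ℝ (Fin n)) :
    f x * volume K ≤ ENNReal.ofReal ((m * Real.exp 1) ^ n) * ∫⁻ y, f y := by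
  have hm1 : (1 : ℝ) ≤ m := by exact_mod_cast hm
  -- This ratio maximises `t * (1 - t) ^ (m - 1)`, whose `n`-th power is the factor lost below.
  set t : ℝ := (m : ℝ)⁻¹ with ht
  have ht0 : 0 ≤ t := by positivity
  have hs0 : 0 ≤ 1 - t := sub_nonneg.2 (inv_le_one_of_one_le₀ hm1)
  have hlow : ∀ y ∈ AffineMap.homothety x t '' K,
      ENNReal.ofReal (1 - t) ^ (n * (m - 1)) * f x ≤ f y := by
    rintro _ ⟨y, hy, rfl⟩
    have h := hf (1 - t) t hs0 ht0 (by ring) x y hy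
    have e : (1 - t) • x + t • y = AffineMap.homothety x t y := by
      rw [AffineMap.homothety_apply, vsub_eq_sub, vadd_eq_add]
      module
    rwa [e] at h
  have hint : ENNReal.ofReal (1 - t) ^ (n * (m - 1)) * f x * (ENNReal.ofReal (t ^ n) * volume K)
      ≤ ∫⁻ y, f y := by
    have hvol := Measure.addHaar_image_homothety volume x t K
    rw [finrank_euclideanSpace_fin, abs_of_nonneg (by positivity)] at hvol
    rw [← hvol]
    exact (mul_le_mul_right (measure_mono hlow) _).trans (mul_meas_ge_le_lintegral hfm _)
  have hreal : 1 ≤ (m * Real.exp 1) ^ n * ((1 - t) ^ (n * (m - 1)) * t ^ n) := by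
    have h := one_le_pow₀ (n := n) (one_le_exp_mul_one_sub_inv_pow hm)
    have e : (m : ℝ) * t = 1 := mul_inv_cancel₀ (by positivity)
    calc (1 : ℝ) ≤ _ := h
      _ = (m * t) ^ n * (Real.exp 1 * (1 - t) ^ (m - 1)) ^ n := by rw [e, one_pow, one_mul]
      _ = _ := by
        rw [mul_comm n, pow_mul]
        ring
  calc f x * volume K
      ≤ ENNReal.ofReal ((m * Real.exp 1) ^ n * ((1 - t) ^ (n * (m - 1)) * t ^ n)) *
          (f x * volume K) := le_mul_of_one_le_left' (by simpa using hreal)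
    _ = ENNReal.ofReal ((m * Real.exp 1) ^ n) *
        (ENNReal.ofReal (1 - t) ^ (n * (m - 1)) * f x * (ENNReal.ofReal (t ^ n) * volume K)) := by
      rw [ENNReal.ofReal_mul (by positivity), ENNReal.ofReal_mul (by positivity),
        ENNReal.ofReal_pow hs0]
      ring
    _ ≤ _ := by gcongr

theorem cond_volume_eq_withDensity {A : Set (EuclideanSpace ℝ (Fin n))} (hA : MeasurableSet A) :
    ProbabilityTheory.cond volume A =
      volume.withDensity (A.indicator fun _ => (volume A)⁻¹) := by
  rw [withDensity_indicator hA, withDensity_const, ProbabilityTheory.cond]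

/-- The sum over `s` of independent vectors, uniform in convex bodies, has a density which decays
like a power of degree `n (#s - 1)`. -/
theorem exists_density_decaysTowards {ι : Type*} {A : ι → Set (EuclideanSpace ℝ (Fin n))}
    (hA : ∀ i, IsConvexBody (A i)) {Ω : Type*} [MeasurableSpace Ω] {P : Measure Ω}
    [IsProbabilityMeasure P] {X : ι → Ω → EuclideanSpace ℝ (Fin n)} (hX : ∀ i, Measurable (X i))
    (hind : iIndepFun X P) (hunif : ∀ i, pdf.IsUniform (X i) (A i) P volume)
    {s : Finset ι} (hs : s.Nonempty) :
    ∃ f, Measurable f ∧ P.map (∑ i ∈ s, X i) = volume.withDensity f ∧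
      DecaysTowards (n * (s.card - 1)) (∑ i ∈ s, A i) f := by
  have hbase (i : ι) : P.map (X i) =
      volume.withDensity ((A i).indicator fun _ => (volume (A i))⁻¹) :=
    (hunif i).trans (cond_volume_eq_withDensity (hA i).measurableSet)
  have hmeas (i : ι) : Measurable ((A i).indicator fun _ => (volume (A i))⁻¹) :=
    measurable_const.indicator (hA i).measurableSet
  -- The induction starts at one summand: the empty sum is a point mass, with no density when `n >
  -- 0`.
  induction hs using Finset.Nonempty.cons_induction with
  | singleton i =>
    refine ⟨_, hmeas i, ?_, ?_⟩
    · simpa using hbase i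
    · simpa using (hA i).convex.decaysTowards_indicator _
  | cons i s hi hs ih =>
    obtain ⟨f, hf, hmap, hdec⟩ := ih
    refine ⟨_, measurable_lconvolution volume (hmeas i) hf, ?_, ?_⟩
    · rw [Finset.sum_cons, (hind.indepFun_finsetSum_of_notMem hX hi).symm.map_add_eq_map_conv_map
        (hX i) (by fun_prop), hbase, hmap, conv_withDensity_eq_lconvolution (hmeas i) hf]
    · have h := ((hA i).convex.decaysTowards_indicator (volume (A i))⁻¹).lconvolution hdec
        (hmeas i) hf
      have e : 0 + n * (s.card - 1) + n = n * ((Finset.cons i s hi).card - 1) := by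
        have := hs.card_pos
        rw [Finset.card_cons, Nat.add_sub_cancel, zero_add, ← Nat.mul_succ]
        congr 1
        omega
      rwa [e, ← Finset.sum_cons] at h

theorem IsDensityOf.one_le_essSup_mul_volume {Ω : Type*} [MeasurableSpace Ω] {P : Measure Ω}
    [IsProbabilityMeasure P] {S : Ω → EuclideanSpace ℝ (Fin n)} (hS : Measurable S)
    {f : EuclideanSpace ℝ (Fin n) → ℝ≥0∞} (hf : IsDensityOf P S f)
    {K : Set (EuclideanSpace ℝ (Fin n))} (hK : MeasurableSet K) (hSK : ∀ᵐ ω ∂P, S ω ∈ K) :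
    1 ≤ essSup f volume * volume K := by
  calc (1 : ℝ≥0∞) = P.map S K := by
        rw [Measure.map_apply hS hK]
        exact (prob_compl_eq_zero_iff (hS hK)).1 hSK |>.symm
    _ = ∫⁻ x in K, f x := by rw [hf.map_eq, withDensity_apply _ hK]
    _ ≤ ∫⁻ _ in K, essSup f volume :=
        lintegral_mono_ae (ae_restrict_of_ae (ENNReal.ae_le_essSup f))
    _ = _ := by rw [setLIntegral_const]

/-- The convolution of the indicators of `A` and `-B` takes the value `|(A - x) ∩ B|` at `x` and has
integral `|A| |B|`, so the case `m = 2` of the decay bound applies without normalising. -/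
theorem iSup_volume_sub_inter_mul_volume_sub_le {A B : Set (EuclideanSpace ℝ (Fin n))}
    (hA : IsConvexBody A) (hB : IsConvexBody B) :
    (⨆ x : EuclideanSpace ℝ (Fin n), volume ((A - {x}) ∩ B)) * volume (A - B) ≤
      ENNReal.ofReal ((2 * Real.exp 1) ^ n) * (volume A * volume B) := by
  set f : EuclideanSpace ℝ (Fin n) → ℝ≥0∞ := A.indicator fun _ => 1 with hf
  set g : EuclideanSpace ℝ (Fin n) → ℝ≥0∞ := (-B).indicator fun _ => 1 with hg
  have hfm : Measurable f := measurable_const.indicator hA.measurableSet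
  have hgm : Measurable g := measurable_const.indicator hB.neg.measurableSet
  have hdec : DecaysTowards (n * (2 - 1)) (A - B) (lconvolution f g volume) := by
    simpa [sub_eq_add_neg] using (hA.convex.decaysTowards_indicator 1).lconvolution
      (hB.neg.convex.decaysTowards_indicator 1) hfm hgm
  have hint : ∫⁻ x, lconvolution f g volume x = volume A * volume B := by
    rw [lintegral_lconvolution hfm hgm, hf, hg, lintegral_indicator_const hA.measurableSet,
      lintegral_indicator_const hB.neg.measurableSet, Measure.measure_neg, one_mul, one_mul]
  rw [ENNReal.iSup_mul]
  refine iSup_le fun x => ?_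
  have hval : lconvolution f g volume x = volume ((A - {x}) ∩ B) := by
    have hAx : MeasurableSet (A - {x}) :=
      by
      rw [sub_eq_add_neg, Set.neg_singleton]
      exact (hA.isCompact.add isCompact_singleton).measurableSet
    rw [lconvolution_def, ← lintegral_add_right_eq_self _ x, ← one_mul (volume (_ ∩ _)),
      ← lintegral_indicator_const (hAx.inter hB.measurableSet)]
    refine lintegral_congr fun y => ?_
    have h1 : y ∈ A - {x} ↔ y + x ∈ A := by
      simp only [Set.mem_sub, Set.mem_singleton_iff, exists_eq_left, sub_eq_iff_eq_add,
        exists_eq_right]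
    have h2 : y ∈ (A - {x}) ∩ B ↔ y + x ∈ A ∧ y ∈ B := and_congr_left' h1
    by_cases h3 : y + x ∈ A <;> by_cases h4 : y ∈ B <;>
      simp only [hf, hg, Set.indicator, h2, h3, h4] <;> simp [h4]
  rw [← hval, ← hint]
  exact_mod_cast hdec.mul_volume_le two_pos (measurable_lconvolution volume hfm hgm) x

end

theorem corollary4p4 (n : ℕ) :
    -- bounds for the maximum `‖f‖ = ess sup f` of the density `f` of `X₁ + ⋯ + X_m`
    (∀ (m : ℕ), 0 < m →
      ∀ (A : Fin m → Set (EuclideanSpace ℝ (Fin n))), (∀ i, IsConvexBody (A i)) →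
      ∀ {Ω : Type*} [MeasurableSpace Ω] (P : MeasureTheory.Measure Ω)
        [MeasureTheory.IsProbabilityMeasure P]
        (X : Fin m → Ω → EuclideanSpace ℝ (Fin n)),
        (∀ i, Measurable (X i)) →
        ProbabilityTheory.iIndepFun X P →
        (∀ i, MeasureTheory.pdf.IsUniform (X i) (A i) P MeasureTheory.volume) →
        (∃ f, IsDensityOf P (fun ω => ∑ i, X i ω) f) ∧
        ∀ f, IsDensityOf P (fun ω => ∑ i, X i ω) f →
          1 ≤ essSup f MeasureTheory.volume * MeasureTheory.volume (∑ i, A i) ∧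
          essSup f MeasureTheory.volume * MeasureTheory.volume (∑ i, A i) ≤
            ENNReal.ofReal ((m * Real.exp 1) ^ n)) ∧
    -- the consequence for a pair of convex bodies
    (∀ A B : Set (EuclideanSpace ℝ (Fin n)), IsConvexBody A → IsConvexBody B →
      (⨆ x : EuclideanSpace ℝ (Fin n), MeasureTheory.volume ((A - {x}) ∩ B)) *
          MeasureTheory.volume (A - B) ≤
        ENNReal.ofReal ((2 * Real.exp 1) ^ n) *
          (MeasureTheory.volume A * MeasureTheory.volume B)) := by
  open MeasureTheory ProbabilityTheory in
  refine ⟨fun m hm A hA Ω _ P _ X hX hind hunif => ?_,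
    fun A B hA hB => iSup_volume_sub_inter_mul_volume_sub_le hA hB⟩
  have : Nonempty (Fin m) := ⟨⟨0, hm⟩⟩
  have hsum : (fun ω => ∑ i, X i ω) = ∑ i, X i := by
    ext1 ω
    rw [Finset.sum_apply]
  obtain ⟨f₀, hf₀, hmap, hdec⟩ :=
    exists_density_decaysTowards hA hX hind hunif Finset.univ_nonempty
  rw [← hsum] at hmap
  have hSm : Measurable fun ω => ∑ i, X i ω := by fun_prop
  have hK : IsCompact (∑ i, A i) :=
    Finset.sum_induction _ IsCompact (fun _ _ => IsCompact.add) isCompact_singleton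
      fun i _ => (hA i).isCompact
  have hSK : ∀ᵐ ω ∂P, ∑ i, X i ω ∈ ∑ i, A i := by
    have hmem (i : Fin m) : ∀ᵐ ω ∂P, X i ω ∈ A i := by
      have h := (hunif i).measure_preimage (hA i).volume_ne_zero (hA i).volume_ne_top
        (hA i).measurableSet.compl
      rw [Set.inter_compl_self, measure_empty, ENNReal.zero_div] at h
      exact h
    filter_upwards [ae_all_iff.2 hmem] with ω hω
    exact Set.finsetSum_mem_finsetSum _ _ _ fun i _ => hω i
  refine ⟨⟨f₀, hf₀.aemeasurable, hmap⟩, fun f hf =>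
    ⟨hf.one_le_essSup_mul_volume hSm hK.measurableSet hSK, ?_⟩⟩
  have hone : ∫⁻ x, f₀ x = 1 := by
    have := Measure.isProbabilityMeasure_map (μ := P) hSm.aemeasurable
    rw [← setLIntegral_univ, ← withDensity_apply _ .univ, ← hmap, measure_univ]
  -- Densities agree almost everywhere, so the essential supremum can be computed on `f₀`, which is
  -- bounded at every point.
  have hae : f =ᵐ[volume] f₀ :=
    (withDensity_eq_iff_of_sigmaFinite hf.aemeasurable hf₀.aemeasurable).1
      (hf.map_eq.symm.trans hmap)
  rw [essSup_congr_ae hae]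
  have hbound (x) : f₀ x * volume (∑ i, A i) ≤ ENNReal.ofReal ((m * Real.exp 1) ^ n) := by
    rw [Finset.card_univ, Fintype.card_fin] at hdec
    simpa [hone] using hdec.mul_volume_le hm hf₀ x
  refine (mul_le_mul_left (essSup_le_iSup (f := f₀)) _).trans ?_
  rw [ENNReal.iSup_mul]
  exact iSup_le hbound
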